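/- Let $S\subseteq\mathbb R$, $\phi>0$, and let $Z_1,Z_2$ be independent Gaussian processes on $S$, each with zero mean, unit variance and exponential correlation function $\rho(h)=\exp(-|h|/\phi)$. Let $\kappa>0$, let $\mu:S\to(0,\infty)$, put $\nu(\kappa)=1/\Gamma(1+1/\kappa)$, and let $Y$ be the regression Weibull process $$Y(s)=\mu(s)\,\nu(\kappa)\,\Bigl(\tfrac{Z_1(s)^2+Z_2(s)^2}{2}\Bigr)^{1/\kappa},\qquad s\in S .$$ Let $n\ge 1$ and let $s_1<\dots<s_n<s_{n+1}$ be points of $S$. Write $\mu_i=\mu(s_i)$ and $\rho_{i,j}=\exp(-|s_i-s_j|/\phi)$, with $\rho_{n-1,n}:=0$ if $n=1$. Let ${}_1F_1(\alpha;\beta;x)=\sum_{k\ge 0}\frac{(\alpha)_k}{(\beta)_k}\frac{x^k}{k!}$. Then for every real $a>0$ the variable $Y(s_{n+1})^a$ is integrable, and for almost every $(y_1,\dots,y_n)$ with respect to the law of $(Y(s_1),\dots,Y(s_n))$, $$\begin{aligned} E\bigl(Y(s_{n+1})^a\mid Y(s_1)=y_1,\dots,Y(s_n)=y_n\bigr)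 ={}&\Gamma\Bigl(\frac a\kappa+1\Bigr)\,(1-\rho_{n,n+1}^2)^{a/\kappa}\,[\nu(\kappa)\mu_{n+1}]^a\\ &\times\exp\Bigl\{-\frac{y_n^\kappa}{(1-\rho_{n-1,n}^2)[\nu(\kappa)\mu_n]^\kappa}\Bigl[\frac{1-\rho_{n-1,n}^2\rho_{n,n+1}^2}{1-\rho_{n,n+1}^2}-1\Bigr]\Bigr\}\\ &\times{}_1F_1\Bigl(\frac a\kappa+1;1;\frac{\rho_{n,n+1}^2\,y_n^\kappa}{[\nu(\kappa)\mu_n]^\kappa(1-\rho_{n,n+1}^2)}\Bigr). \end{aligned}$$ Moreover, the right-hand side for $a=1$, evaluated at $(Y(s_1),\dots,Y(s_n))$, is the optimal predictor of $Y(s_{n+1})$: its mean squared prediction error is finite and minimal among all predictors $g(Y(s_1),\dots,Y(s_n))$ with $g$ measurable, and it is the only minimiser up to almost sure equality. -/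

import Mathlib

open MeasureTheory ProbabilityTheory

noncomputable section

/-- The exponential correlation function `ρ(h) = exp (-|h| / φ)` with range parameter `φ`. -/
def expCorr (φ h : ℝ) : ℝ := Real.exp (-|h| / φ)

/-- `Z` is a Gaussian process on `S ⊆ ℝ` with zero mean, unit variance and exponential
correlation function. -/
structure IsExpGaussianProcess {Ω : Type*} [MeasurableSpace Ω] {S : Set ℝ} (φ : ℝ)
    (Z : S → Ω → ℝ) (P : Measure Ω) : Prop where
  measurable : ∀ t, Measurable (Z t)
  gaussian : IsGaussianProcess Z P
  mean_zero : ∀ t, ∫ ω, Z t ω ∂P = 0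
  covariance : ∀ t u : S, covariance (Z t) (Z u) P = expCorr φ ((t : ℝ) - (u : ℝ))

/-- The scaled chi-square process `X_m(t) = ∑ₖ Z_k(t)² / m`. -/
def scaledChiSq {Ω T : Type*} {m : ℕ} (Z : Fin m → T → Ω → ℝ) (t : T) (ω : Ω) : ℝ :=
  ∑ k, Z k t ω ^ 2 / (m : ℝ)

/-- The normalising constant `ν(κ) = 1 / Γ(1 + 1/κ)`. -/
def weibullScale (κ : ℝ) : ℝ := (Real.Gamma (1 + 1 / κ))⁻¹

/-- The Weibull process `W(t) = ν(κ) X₂(t)^(1/κ)`. -/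
def weibullProcess {Ω T : Type*} (κ : ℝ) (Z : Fin 2 → T → Ω → ℝ) (t : T) (ω : Ω) : ℝ :=
  weibullScale κ * scaledChiSq Z t ω ^ (1 / κ)

/-- The regression Weibull process `Y(t) = μ(t) W(t)`. -/
def regWeibullProcess {Ω T : Type*} (κ : ℝ) (μ : T → ℝ) (Z : Fin 2 → T → Ω → ℝ)
    (t : T) (ω : Ω) : ℝ :=
  μ t * weibullProcess κ Z t ω

/-- The confluent hypergeometric function `₁F₁(a; b; x) = ∑ₖ (a)ₖ / (b)ₖ · xᵏ / k!`, where
`(a)ₖ = a (a + 1) ⋯ (a + k - 1)`. -/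
def hyp1F1 (a b x : ℝ) : ℝ :=
  ∑' k : ℕ, (ascPochhammer ℝ k).eval a / (ascPochhammer ℝ k).eval b * (x ^ k / (k.factorial : ℝ))

/-- The closed form of the conditional moment of order `a`. Here `r = ρ_{n-1,n}`,
`q = ρ_{n,n+1}`, `μ₀ = μ(s_n)`, `μ₁ = μ(s_{n+1})` and `y = y_n`. -/
def weibullCondMoment (κ a r q μ₀ μ₁ y : ℝ) : ℝ :=
  Real.Gamma (a / κ + 1) * (1 - q ^ 2) ^ (a / κ) * (weibullScale κ * μ₁) ^ a
    * Real.exp (-(y ^ κ / ((1 - r ^ 2) * (weibullScale κ * μ₀) ^ κ)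
        * ((1 - r ^ 2 * q ^ 2) / (1 - q ^ 2) - 1)))
    * hyp1F1 (a / κ + 1) 1 (q ^ 2 * y ^ κ / ((weibullScale κ * μ₀) ^ κ * (1 - q ^ 2)))

/-- The mean squared prediction error `E (U - V)²`, as an extended nonnegative number. -/
def mspe {Ω : Type*} [MeasurableSpace Ω] (P : Measure Ω) (U V : Ω → ℝ) : ENNReal :=
  ∫⁻ ω, ENNReal.ofReal ((U ω - V ω) ^ 2) ∂P

/-- `g` is a predictor of `U` from the observations `O` with minimal (finite) mean squared
prediction error among all measurable functions of the observations, and it is the only such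
predictor up to almost sure equality. -/
def IsOptimalPredictor {Ω β : Type*} [MeasurableSpace Ω] [MeasurableSpace β] (P : Measure Ω)
    (U : Ω → ℝ) (O : Ω → β) (g : β → ℝ) : Prop :=
  Measurable g ∧ mspe P U (fun ω ↦ g (O ω)) < ⊤ ∧
    ∀ f : β → ℝ, Measurable f →
      mspe P U (fun ω ↦ g (O ω)) ≤ mspe P U (fun ω ↦ f (O ω)) ∧
      (mspe P U (fun ω ↦ f (O ω)) = mspe P U (fun ω ↦ g (O ω)) →
        (fun ω ↦ f (O ω)) =ᵐ[P] fun ω ↦ g (O ω))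

end

/-! Let `u` and `t` be the last observed and the predicted location, and `q` their correlation. The
exponential correlation is multiplicative over adjacent intervals, so each innovation `Z k t - q * Z
k u` is uncorrelated with the process up to `u`. By joint Gaussianity it is independent of that past
(`indepFun_past_innovation`). Given the past, the pair of values at `t` is therefore planar
Gaussian, with mean `q` times the pair at `u` and covariance `(1 - q ^ 2) • 1`.

Half the squared norm of such a vector is a Poisson mixture of gamma variables
(`map_half_sq_norm_gaussianReal_prod`), as Laplace transforms show. Its moment of order `a / κ` is
then a Poisson-weighted sum of gamma moments, which is the `₁F₁` series.

This moment sees the mean vector only through its norm, hence only through `Y u`. Conditioning on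
the whole Gaussian past thus produces a function of the observed `Y` alone, which must also be the
conditional expectation given the observations (`IndepFun.condExp_comp_prodMk_eq`). The correlation
`r` cancels from the closed form (`weibullCondMoment_eq`). Optimality for `a = 1` is the projection
property of conditional expectation in `L²`. -/

open scoped ENNReal NNReal

/-! ### Laplace transforms: uniqueness, gamma and squared Gaussian cases -/

/-- A finite measure on `ℝ` is determined by its Laplace transform on a half-line containing `0`
in its interior. -/
theorem MeasureTheory.Measure.ext_of_lintegral_exp_eq {μ ν : Measure ℝ} {c : ℝ} (hc : 0 < c)
    (hfin : ∀ t < c, ∫⁻ x, ENNReal.ofReal (Real.exp (t * x)) ∂μ ≠ ∞)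
    (h : ∀ t < c, ∫⁻ x, ENNReal.ofReal (Real.exp (t * x)) ∂μ
      = ∫⁻ x, ENNReal.ofReal (Real.exp (t * x)) ∂ν) : μ = ν := by
  have hμ : IsFiniteMeasure μ := ⟨by simpa using (hfin 0 hc).lt_top⟩
  have hν : IsFiniteMeasure ν := ⟨by
    have := (h 0 hc) ▸ (hfin 0 hc).lt_top
    simpa using this⟩
  have hint (ρ : Measure ℝ) (hρ : ∀ t < c, ∫⁻ x, ENNReal.ofReal (Real.exp (t * x)) ∂ρ ≠ ∞) :
      Set.Iio c ⊆ interior (integrableExpSet id ρ) := by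
    refine interior_maximal (fun t ht ↦ ?_) isOpen_Iio
    refine (lintegral_ofReal_ne_top_iff_integrable (by fun_prop) ?_).1 (hρ t ht)
    exact ae_of_all _ fun x ↦ (Real.exp_pos _).le
  have hμi := hint μ hfin
  have hνi := hint ν fun t ht ↦ (h t ht) ▸ hfin t ht
  have hmgf (t : ℝ) (ht : t < c) : mgf id μ t = mgf id ν t := by
    simp only [mgf, id]
    rw [integral_eq_lintegral_of_nonneg_ae (ae_of_all _ fun x ↦ (Real.exp_pos _).le)
      (by fun_prop), integral_eq_lintegral_of_nonneg_ae
      (ae_of_all _ fun x ↦ (Real.exp_pos _).le) (by fun_prop), h t ht]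
  -- Identity theorem on the half-plane `re z < c`: agreement on real points accumulating at `0`
  -- suffices. Since `0 < c`, the half-plane contains the imaginary axis, where the transforms are
  -- the characteristic functions.
  have hEq : Set.EqOn (complexMGF id μ) (complexMGF id ν) {z | z.re ∈ Set.Iio c} := by
    refine AnalyticOnNhd.eqOn_of_preconnected_of_frequently_eq
      (analyticOnNhd_complexMGF.mono fun z hz ↦ hμi hz)
      (analyticOnNhd_complexMGF.mono fun z hz ↦ hνi hz)
      ((convex_Iio c).linear_preimage Complex.reLm).isPreconnected (z₀ := ((0 : ℝ) : ℂ))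
      (by simpa using hc) ?_
    have h_real : ∃ᶠ (x : ℝ) in nhdsWithin 0 {0}ᶜ, complexMGF id μ x = complexMGF id ν x := by
      refine Filter.Eventually.frequently ?_
      filter_upwards [nhdsWithin_le_nhds (Iio_mem_nhds hc)] with x hx
      rw [complexMGF_ofReal, complexMGF_ofReal, hmgf x hx]
    have htend : Filter.Tendsto (fun x : ℝ ↦ (x : ℂ)) (nhdsWithin 0 {0}ᶜ)
        (nhdsWithin ((0 : ℝ) : ℂ) {((0 : ℝ) : ℂ)}ᶜ) := by
      refine tendsto_nhdsWithin_iff.2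
        ⟨(Complex.continuous_ofReal.tendsto 0).mono_left nhdsWithin_le_nhds, ?_⟩
      filter_upwards [self_mem_nhdsWithin] with x hx
      simpa using hx
    exact htend.frequently h_real
  refine Measure.ext_of_charFun (funext fun t ↦ ?_)
  have := hEq (show (Complex.I * t : ℂ) ∈ {z : ℂ | z.re ∈ Set.Iio c} by simpa using hc)
  rwa [mul_comm, complexMGF_id_mul_I, complexMGF_id_mul_I] at this

/-- The Laplace transform of `x ↦ x ^ α` against the gamma distribution. -/
theorem ProbabilityTheory.lintegral_rpow_mul_exp_gammaMeasure {a r α t : ℝ} (ha : 0 < a)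
    (hα : 0 ≤ α) (htr : t < r) (hr : 0 < r) :
    ∫⁻ x, ENNReal.ofReal (x ^ α * Real.exp (t * x)) ∂(gammaMeasure a r)
      = ENNReal.ofReal (r ^ a / Real.Gamma a * (Real.Gamma (a + α) / (r - t) ^ (a + α))) := by
  have hrt : 0 < r - t := sub_pos.2 htr
  have haα : 0 < a + α := by positivity
  set C : ℝ := r ^ a / Real.Gamma a * (Real.Gamma (a + α) / (r - t) ^ (a + α)) with hC
  have hΓ := Real.Gamma_pos_of_pos ha
  have hΓ' := Real.Gamma_pos_of_pos haα
  have hC0 : 0 ≤ C := by positivity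
  rw [gammaMeasure, lintegral_withDensity_eq_lintegral_mul _
    (by unfold gammaPDF; fun_prop) (by fun_prop)]
  have : ∀ᵐ x : ℝ, (gammaPDF a r * fun x ↦ ENNReal.ofReal (x ^ α * Real.exp (t * x))) x
      = ENNReal.ofReal C * gammaPDF (a + α) (r - t) x := by
    -- The point `0` is discarded because the power law for `x ^ (a - 1) * x ^ α` can fail there.
    filter_upwards [Measure.ae_ne volume (0 : ℝ)] with x hx
    rcases lt_or_gt_of_ne hx with hx | hx
    · simp [gammaPDF_of_neg hx]
    · rw [Pi.mul_apply, gammaPDF_of_nonneg hx.le, gammaPDF_of_nonneg hx.le,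
        ← ENNReal.ofReal_mul (by positivity), ← ENNReal.ofReal_mul hC0]
      congr 1
      have e1 : x ^ (a + α - 1) = x ^ (a - 1) * x ^ α := by
        rw [← Real.rpow_add hx]; ring_nf
      have e2 : Real.exp (-((r - t) * x)) = Real.exp (-(r * x)) * Real.exp (t * x) := by
        rw [← Real.exp_add]; ring_nf
      have : 0 < (r - t) ^ (a + α) := by positivity
      rw [e1, e2, hC]
      field_simp
  rw [lintegral_congr_ae this, lintegral_const_mul' _ _ ENNReal.ofReal_ne_top,
    lintegral_gammaPDF_eq_one haα hrt, mul_one]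

/-- The Laplace transform of half the square of a Gaussian variable. -/
theorem ProbabilityTheory.lintegral_exp_sq_gaussianReal (m : ℝ) {v : ℝ≥0} (hv : v ≠ 0) {t : ℝ}
    (ht : t < (v : ℝ)⁻¹) :
    ∫⁻ x, ENNReal.ofReal (Real.exp (t * (x ^ 2 / 2))) ∂(gaussianReal m v)
      = ENNReal.ofReal ((√(1 - t * v))⁻¹ * Real.exp (t * m ^ 2 / (2 * (1 - t * v)))) := by
  have hv0 : (0 : ℝ) < v := by positivity
  have hd : 0 < 1 - t * v := by
    have := mul_lt_mul_of_pos_right ht hv0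
    rw [inv_mul_cancel₀ hv0.ne'] at this
    linarith
  set d : ℝ≥0 := ⟨1 - t * v, hd.le⟩ with hdd
  have hdc : (d : ℝ) = 1 - t * v := rfl
  have hd0 : d ≠ 0 := fun h ↦ hd.ne' (by rw [← hdc, h]; rfl)
  set C : ℝ := (√(1 - t * v))⁻¹ * Real.exp (t * m ^ 2 / (2 * (1 - t * v))) with hC
  rw [gaussianReal_of_var_ne_zero _ hv, lintegral_withDensity_eq_lintegral_mul _
    (by fun_prop) (by fun_prop)]
  -- Completing the square: the exponential tilt turns the density into `C` times that of mean `m /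
  -- d` and variance `v / d`, where `d = 1 - t * v`.
  have : ∀ x : ℝ, (gaussianPDF m v * fun x ↦ ENNReal.ofReal (Real.exp (t * (x ^ 2 / 2)))) x
      = ENNReal.ofReal C * gaussianPDF (m / d) (v / d) x := by
    intro x
    rw [Pi.mul_apply, gaussianPDF, gaussianPDF,
      ← ENNReal.ofReal_mul (gaussianPDFReal_nonneg _ _ _), ← ENNReal.ofReal_mul (by positivity)]
    congr 1
    simp only [gaussianPDFReal, NNReal.coe_div]
    rw [hC, ← hdc]
    have hdp : (0 : ℝ) < d := hd
    have e1 : √(2 * Real.pi * (v / d)) = √(2 * Real.pi * v) * (√(d : ℝ))⁻¹ := by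
      rw [← Real.sqrt_inv, ← Real.sqrt_mul (by positivity)]; congr 1; field_simp
    rw [e1, mul_assoc, ← Real.exp_add, mul_inv, inv_inv]
    have e2 : -(x - m) ^ 2 / (2 * (v : ℝ)) + t * (x ^ 2 / 2)
        = t * m ^ 2 / (2 * d) + -(x - m / d) ^ 2 / (2 * (v / d)) := by
      have ht' : t = (1 - d) / v := by rw [hdc]; field_simp; ring
      rw [ht']
      field_simp
      ring
    rw [e2, Real.exp_add]
    have : √(d : ℝ) ≠ 0 := by positivity
    field_simp
  rw [lintegral_congr this, lintegral_const_mul' _ _ ENNReal.ofReal_ne_top,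
    lintegral_gaussianPDF_eq_one _ (div_ne_zero hv hd0), mul_one]

/-! ### Noncentral chi-square law as a Poisson mixture -/

/-- Half the squared norm of a planar Gaussian vector with covariance `v • 1` is a Poisson mixture
of gamma variables. -/
theorem ProbabilityTheory.map_half_sq_norm_gaussianReal_prod (m₁ m₂ : ℝ) {v : ℝ≥0} (hv : v ≠ 0) :
    ((gaussianReal m₁ v).prod (gaussianReal m₂ v)).map (fun p ↦ (p.1 ^ 2 + p.2 ^ 2) / 2)
      = Measure.sum fun j : ℕ ↦ ENNReal.ofReal (Real.exp (-((m₁ ^ 2 + m₂ ^ 2) / (2 * v)))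
          * (((m₁ ^ 2 + m₂ ^ 2) / (2 * v)) ^ j / (j.factorial : ℝ)))
          • gammaMeasure (j + 1) (v : ℝ)⁻¹ := by
  have hv0 : (0 : ℝ) < v := by positivity
  have hv1 : (0 : ℝ) < (v : ℝ)⁻¹ := by positivity
  set l : ℝ := (m₁ ^ 2 + m₂ ^ 2) / (2 * v) with hl
  have hl0 : 0 ≤ l := by positivity
  have key (t : ℝ) (ht : t < (v : ℝ)⁻¹) :
      ∫⁻ x, ENNReal.ofReal (Real.exp (t * x))
        ∂(((gaussianReal m₁ v).prod (gaussianReal m₂ v)).map (fun p ↦ (p.1 ^ 2 + p.2 ^ 2) / 2))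
        = ENNReal.ofReal ((1 - t * v)⁻¹ * Real.exp (t * (m₁ ^ 2 + m₂ ^ 2) / (2 * (1 - t * v)))) := by
    have hd : 0 < 1 - t * v := by
      have := mul_lt_mul_of_pos_right ht hv0
      rw [inv_mul_cancel₀ hv0.ne'] at this
      linarith
    rw [lintegral_map (by fun_prop) (by fun_prop)]
    have : ∀ p : ℝ × ℝ, ENNReal.ofReal (Real.exp (t * ((p.1 ^ 2 + p.2 ^ 2) / 2)))
        = ENNReal.ofReal (Real.exp (t * (p.1 ^ 2 / 2)))
          * ENNReal.ofReal (Real.exp (t * (p.2 ^ 2 / 2))) := fun p ↦ by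
      rw [← ENNReal.ofReal_mul (by positivity), ← Real.exp_add]; ring_nf
    simp_rw [this]
    rw [lintegral_prod_mul (f := fun x ↦ ENNReal.ofReal (Real.exp (t * (x ^ 2 / 2))))
      (g := fun x ↦ ENNReal.ofReal (Real.exp (t * (x ^ 2 / 2)))) (by fun_prop) (by fun_prop),
      lintegral_exp_sq_gaussianReal _ hv ht,
      lintegral_exp_sq_gaussianReal _ hv ht, ← ENNReal.ofReal_mul (by positivity),
      mul_mul_mul_comm, ← Real.exp_add, ← mul_inv, Real.mul_self_sqrt hd.le]
    ring_nf
  refine Measure.ext_of_lintegral_exp_eq hv1 (fun t ht ↦ by rw [key t ht]; exact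
    ENNReal.ofReal_ne_top) fun t ht ↦ ?_
  rw [key t ht, lintegral_sum_measure]
  have hd : 0 < 1 - t * v := by
    have := mul_lt_mul_of_pos_right ht hv0
    rw [inv_mul_cancel₀ hv0.ne'] at this
    linarith
  have hterm (j : ℕ) : ∫⁻ x, ENNReal.ofReal (Real.exp (t * x))
      ∂(ENNReal.ofReal (Real.exp (-l) * (l ^ j / (j.factorial : ℝ))) • gammaMeasure (j + 1) (v : ℝ)⁻¹)
      = ENNReal.ofReal (Real.exp (-l) * (1 - t * v)⁻¹
          * ((l / (1 - t * v)) ^ j / (j.factorial : ℝ))) := by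
    have := lintegral_rpow_mul_exp_gammaMeasure (a := j + 1) (α := 0) (by positivity) le_rfl ht hv1
    simp only [Real.rpow_zero, one_mul, add_zero] at this
    rw [lintegral_smul_measure, this, smul_eq_mul, ← ENNReal.ofReal_mul (by positivity)]
    congr 1
    have hΓ : 0 < Real.Gamma ((j : ℝ) + 1) := Real.Gamma_pos_of_pos (by positivity)
    have hj : ((j : ℝ) + 1) = ((j + 1 : ℕ) : ℝ) := by push_cast; rfl
    have e : (v : ℝ)⁻¹ - t = (v : ℝ)⁻¹ * (1 - t * v) := by field_simp
    rw [div_mul_div_cancel₀ hΓ.ne', hj, Real.rpow_natCast, Real.rpow_natCast, e, mul_pow, div_pow l (1 - t * v), pow_succ (1 - t * v)]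
    field_simp
  simp_rw [hterm]
  -- The Poisson weights sum to an exponential with total exponent `l / (1 - t * v) - l`, which is
  -- the exponent found in `key`.
  rw [← ENNReal.ofReal_tsum_of_nonneg (fun j ↦ by positivity)
    ((Real.summable_pow_div_factorial _).mul_left _), tsum_mul_left,
    ← congrFun NormedSpace.exp_eq_tsum_div _, ← Real.exp_eq_exp_ℝ]
  rw [mul_comm (Real.exp (-l)), mul_assoc, ← Real.exp_add]
  congr 3
  rw [hl]
  field_simp
  ring

/-! ### The series `₁F₁` and the moments of the mixture -/

theorem ascPochhammer_eval_eq_Gamma_div {x : ℝ} (hx : 0 < x) (k : ℕ) :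
    (ascPochhammer ℝ k).eval x = Real.Gamma (x + k) / Real.Gamma x := by
  have hΓ := (Real.Gamma_pos_of_pos hx).ne'
  induction k with
  | zero => simp [hΓ]
  | succ k ih =>
    have : x + (k : ℝ) ≠ 0 := by positivity
    rw [ascPochhammer_succ_eval, ih, Nat.cast_succ, ← add_assoc, Real.Gamma_add_one this]
    ring

theorem summable_hyp1F1 {a b : ℝ} (ha : 0 < a) (hb : 0 < b) (x : ℝ) :
    Summable fun k : ℕ ↦ (ascPochhammer ℝ k).eval a / (ascPochhammer ℝ k).eval b
      * (x ^ k / (k.factorial : ℝ)) := by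
  -- Dominating by the series at `|x| + 1` keeps every term positive, so the ratio test never
  -- divides by zero.
  suffices ∀ y : ℝ, 0 < y → Summable fun k : ℕ ↦ (ascPochhammer ℝ k).eval a
      / (ascPochhammer ℝ k).eval b * (y ^ k / (k.factorial : ℝ)) by
    refine Summable.of_norm_bounded (this (|x| + 1) (by positivity)) fun k ↦ ?_
    have h1 := ascPochhammer_pos k a ha
    have h2 := ascPochhammer_pos k b hb
    rw [norm_mul, Real.norm_of_nonneg (by positivity), norm_div, norm_pow, Real.norm_natCast,
      Real.norm_eq_abs]
    gcongr
    linarith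
  intro y hy
  refine summable_of_ratio_test_tendsto_lt_one (l := 0) one_pos
    (Filter.Eventually.of_forall fun k ↦ ?_) ?_
  · have h1 := ascPochhammer_pos k a ha
    have h2 := ascPochhammer_pos k b hb
    positivity
  · have hev (k : ℕ) : ‖(ascPochhammer ℝ (k + 1)).eval a / (ascPochhammer ℝ (k + 1)).eval b
        * (y ^ (k + 1) / ((k + 1).factorial : ℝ))‖ / ‖(ascPochhammer ℝ k).eval a
        / (ascPochhammer ℝ k).eval b * (y ^ k / (k.factorial : ℝ))‖
        = (a + (1 : ℝ) * k) / (b + (1 : ℝ) * k) * (y / ((k : ℝ) + 1)) := by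
      have h1 := ascPochhammer_pos k a ha
      have h2 := ascPochhammer_pos k b hb
      have h3 := ascPochhammer_pos (k + 1) a ha
      have h4 := ascPochhammer_pos (k + 1) b hb
      rw [Real.norm_of_nonneg (by positivity), Real.norm_of_nonneg (by positivity),
        ascPochhammer_succ_eval, ascPochhammer_succ_eval, Nat.factorial_succ, pow_succ]
      push_cast
      field_simp
    simp_rw [hev]
    have h1 : Filter.Tendsto (fun k : ℕ ↦ (a + (1 : ℝ) * k) / (b + (1 : ℝ) * k)) Filter.atTop
        (nhds (1 / 1)) := tendsto_add_mul_div_add_mul_atTop_nhds a b 1 one_ne_zero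
    have h2 : Filter.Tendsto (fun k : ℕ ↦ y / ((k : ℝ) + 1)) Filter.atTop (nhds 0) :=
      tendsto_const_nhds.div_atTop
        (Filter.tendsto_atTop_add_const_right _ _ tendsto_natCast_atTop_atTop)
    simpa using h1.mul h2

theorem measurable_hyp1F1 {a b : ℝ} (ha : 0 < a) (hb : 0 < b) : Measurable (hyp1F1 a b) := by
  refine measurable_of_tendsto_metrizable (f := fun (n : ℕ) (x : ℝ) ↦ ∑ k ∈ Finset.range n,
    (ascPochhammer ℝ k).eval a / (ascPochhammer ℝ k).eval b * (x ^ k / (k.factorial : ℝ)))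
    (fun n ↦ by fun_prop) (tendsto_pi_nhds.2 fun x ↦ ?_)
  exact (summable_hyp1F1 ha hb x).hasSum.tendsto_sum_nat

/-- The moments of half the squared norm of a planar Gaussian vector with covariance `v • 1`. -/
theorem ProbabilityTheory.lintegral_half_sq_norm_rpow_gaussianReal_prod (m₁ m₂ : ℝ) {v : ℝ≥0}
    (hv : v ≠ 0) {α : ℝ} (hα : 0 ≤ α) :
    ∫⁻ p, ENNReal.ofReal (((p.1 ^ 2 + p.2 ^ 2) / 2) ^ α)
        ∂((gaussianReal m₁ v).prod (gaussianReal m₂ v))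
      = ENNReal.ofReal (Real.Gamma (α + 1) * (v : ℝ) ^ α
          * Real.exp (-((m₁ ^ 2 + m₂ ^ 2) / (2 * v)))
          * hyp1F1 (α + 1) 1 ((m₁ ^ 2 + m₂ ^ 2) / (2 * v))) := by
  have hv0 : (0 : ℝ) < v := by positivity
  have hα1 : 0 < α + 1 := by positivity
  have hΓ := Real.Gamma_pos_of_pos hα1
  rw [← lintegral_map (f := fun x ↦ ENNReal.ofReal (x ^ α))
    (g := fun p : ℝ × ℝ ↦ (p.1 ^ 2 + p.2 ^ 2) / 2) (by fun_prop) (by fun_prop),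
    map_half_sq_norm_gaussianReal_prod _ _ hv, lintegral_sum_measure]
  set l : ℝ := (m₁ ^ 2 + m₂ ^ 2) / (2 * v) with hl
  have hl0 : 0 ≤ l := by positivity
  have hterm (j : ℕ) : ∫⁻ x, ENNReal.ofReal (x ^ α)
      ∂(ENNReal.ofReal (Real.exp (-l) * (l ^ j / (j.factorial : ℝ))) • gammaMeasure (j + 1) (v : ℝ)⁻¹)
      = ENNReal.ofReal (Real.Gamma (α + 1) * (v : ℝ) ^ α * Real.exp (-l)
          * ((ascPochhammer ℝ j).eval (α + 1) / (ascPochhammer ℝ j).eval 1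
            * (l ^ j / (j.factorial : ℝ)))) := by
    have := lintegral_rpow_mul_exp_gammaMeasure (a := j + 1) (t := 0) (by positivity) hα
      (inv_pos.2 hv0) (inv_pos.2 hv0)
    simp only [zero_mul, Real.exp_zero, mul_one, sub_zero] at this
    have hj : 0 < Real.Gamma ((j : ℝ) + 1) := Real.Gamma_pos_of_pos (by positivity)
    have hja : 0 < Real.Gamma ((j : ℝ) + 1 + α) := Real.Gamma_pos_of_pos (by positivity)
    -- Both Pochhammer symbols become Gamma quotients; `Γ(j + 1)` in the gamma moment is the symbol
    -- `(1)_j`.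
    rw [lintegral_smul_measure, this, smul_eq_mul, ← ENNReal.ofReal_mul (by positivity),
      ascPochhammer_eval_eq_Gamma_div hα1, ascPochhammer_eval_eq_Gamma_div one_pos,
      Real.Gamma_one, div_one, add_comm (1 : ℝ), show α + 1 + (j : ℝ) = j + 1 + α by ring,
      Real.rpow_add (inv_pos.2 hv0) ((j : ℝ) + 1) α, Real.inv_rpow hv0.le α]
    congr 1
    have : (0 : ℝ) < (v : ℝ) ^ α := by positivity
    have : (0 : ℝ) < (v : ℝ)⁻¹ ^ ((j : ℝ) + 1) := by positivity
    field_simp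
  simp_rw [hterm]
  rw [← ENNReal.ofReal_tsum_of_nonneg _ ((summable_hyp1F1 hα1 one_pos _).mul_left _),
    tsum_mul_left]
  · rfl
  · intro j
    have h1 := ascPochhammer_pos j _ hα1
    have h2 := ascPochhammer_pos j (1 : ℝ) one_pos
    positivity

theorem hyp1F1_nonneg {a b x : ℝ} (ha : 0 < a) (hb : 0 < b) (hx : 0 ≤ x) : 0 ≤ hyp1F1 a b x :=
  tsum_nonneg fun k ↦ by
    have h1 := ascPochhammer_pos k a ha
    have h2 := ascPochhammer_pos k b hb
    positivity

/-! ### Gaussian processes with exponential correlation -/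

/-- Independent Gaussian processes are jointly Gaussian. -/
theorem ProbabilityTheory.iIndepFun.isGaussianProcess {Ω ι T : Type*} [MeasurableSpace Ω]
    {P : Measure Ω} [Fintype ι] {Z : ι → T → Ω → ℝ} (hZ : ∀ k, IsGaussianProcess (Z k) P)
    (hindep : iIndepFun (fun (k : ι) (ω : Ω) (t : T) ↦ Z k t ω) P) :
    IsGaussianProcess (fun (p : ι × T) ↦ Z p.1 p.2) P where
  hasGaussianLaw I := by
    classical
    -- A finite set of pairs need not be a product, so all components are taken on the common time
    -- set `J` and the needed coordinates are then projected out.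
    let J : Finset T := I.image Prod.snd
    have hJ : iIndepFun (fun (k : ι) (ω : Ω) ↦ J.restrict (Z k · ω)) P :=
      hindep.comp (fun _ z ↦ J.restrict z) fun _ ↦ by fun_prop
    have h := hJ.hasGaussianLaw fun k ↦ (hZ k).hasGaussianLaw J
    let L : (ι → J → ℝ) →L[ℝ] (I → ℝ) :=
      { toFun x p := x p.1.1 ⟨p.1.2, Finset.mem_image_of_mem _ p.2⟩
        map_add' x y := rfl
        map_smul' c x := rfl }
    exact h.map L

theorem expCorr_nonneg (φ h : ℝ) : 0 ≤ expCorr φ h := (Real.exp_pos _).le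

theorem expCorr_zero (φ : ℝ) : expCorr φ 0 = 1 := by simp [expCorr]

theorem expCorr_neg (φ h : ℝ) : expCorr φ (-h) = expCorr φ h := by simp [expCorr]

theorem expCorr_add {φ g h : ℝ} (hg : 0 ≤ g) (hh : 0 ≤ h) :
    expCorr φ (g + h) = expCorr φ g * expCorr φ h := by
  rw [expCorr, expCorr, expCorr, ← Real.exp_add, abs_of_nonneg hg, abs_of_nonneg hh,
    abs_of_nonneg (add_nonneg hg hh)]
  ring_nf

theorem expCorr_lt_one {φ h : ℝ} (hφ : 0 < φ) (hh : h ≠ 0) : expCorr φ h < 1 := by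
  rw [expCorr, Real.exp_lt_one_iff, neg_div, neg_lt_zero]
  positivity

theorem expCorr_sq_lt_one {φ h : ℝ} (hφ : 0 < φ) (hh : h ≠ 0) : expCorr φ h ^ 2 < 1 :=
  pow_lt_one₀ (expCorr_nonneg _ _) (expCorr_lt_one hφ hh) two_ne_zero

namespace IsExpGaussianProcess

variable {Ω : Type*} [MeasurableSpace Ω] {P : Measure Ω} {S : Set ℝ} {φ : ℝ}

theorem memLp {Z : S → Ω → ℝ} (hZ : IsExpGaussianProcess φ Z P) (t : S) : MemLp (Z t) 2 P :=
  (hZ.gaussian.hasGaussianLaw_eval t).memLp_two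

/-- The law of `Z t - c Z u`. -/
theorem map_sub_const_mul {Z : S → Ω → ℝ} (hZ : IsExpGaussianProcess φ Z P) (t u : S) (c : ℝ) :
    P.map (fun ω ↦ Z t ω - c * Z u ω)
      = gaussianReal 0 (1 - 2 * c * expCorr φ (t - u) + c ^ 2).toNNReal := by
  have := hZ.gaussian.isProbabilityMeasure
  have ht := hZ.memLp t
  have hu := hZ.memLp u
  have hcu : MemLp (fun ω ↦ c * Z u ω) 2 P := hu.const_mul c
  have hg : HasGaussianLaw (fun ω ↦ Z t ω - c * Z u ω) P := by
    have h2 := hZ.gaussian.hasGaussianLaw_prodMk (s := t) (t := u)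
    exact h2.map_fun (ContinuousLinearMap.fst ℝ ℝ ℝ - c • ContinuousLinearMap.snd ℝ ℝ ℝ)
  have hmean : ∫ ω, (Z t ω - c * Z u ω) ∂P = 0 := by
    rw [integral_sub (ht.integrable one_le_two) (hcu.integrable one_le_two),
      integral_const_mul, hZ.mean_zero, hZ.mean_zero]
    simp
  have hvar : Var[fun ω ↦ Z t ω - c * Z u ω; P] = 1 - 2 * c * expCorr φ (t - u) + c ^ 2 := by
    have hsub : MemLp (fun ω ↦ Z t ω - c * Z u ω) 2 P := ht.sub hcu
    rw [← covariance_self hsub.aemeasurable,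
      covariance_fun_sub_fun_sub ht hcu ht hcu, covariance_const_mul_left,
      covariance_const_mul_right, covariance_const_mul_right, covariance_const_mul_left,
      hZ.covariance, hZ.covariance, hZ.covariance, hZ.covariance, sub_self, sub_self, expCorr_zero,
      ← neg_sub (t : ℝ), expCorr_neg]
    ring
  rw [hg.map_eq_gaussianReal, hmean, hvar]

/-- The Markov property: the innovation `Z t - ρ(t - u) Z u` is uncorrelated with the past. -/
theorem covariance_innovation {Z : S → Ω → ℝ} (hZ : IsExpGaussianProcess φ Z P) {x u t : S}
    (hxu : x ≤ u) (hut : u ≤ t) :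
    cov[fun ω ↦ Z t ω - expCorr φ (t - u) * Z u ω, Z x; P] = 0 := by
  have := hZ.gaussian.isProbabilityMeasure
  have hxu' : (0 : ℝ) ≤ u - x := sub_nonneg.2 hxu
  have hut' : (0 : ℝ) ≤ t - u := sub_nonneg.2 hut
  rw [covariance_fun_sub_left (hZ.memLp t) ((hZ.memLp u).const_mul _) (hZ.memLp x),
    covariance_const_mul_left, hZ.covariance, hZ.covariance,
    ← sub_add_sub_cancel (t : ℝ) u x, expCorr_add hut' hxu', sub_self]

/-- The innovations are independent of the past. -/
theorem indepFun_past_innovation {ι : Type*} [Fintype ι] {Z : ι → S → Ω → ℝ}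
    (hZ : ∀ k, IsExpGaussianProcess φ (Z k) P)
    (hindep : iIndepFun (fun (k : ι) (ω : Ω) (t : S) ↦ Z k t ω) P) {u t : S} (hut : u ≤ t) :
    IndepFun (fun ω (p : ι × Set.Iic u) ↦ Z p.1 p.2 ω)
      (fun ω (k : ι) ↦ Z k t ω - expCorr φ (t - u) * Z k u ω) P := by
  classical
  have hP := hindep.isProbabilityMeasure
  have hG := hindep.isGaussianProcess fun k ↦ (hZ k).gaussian
  refine IsGaussianProcess.indepFun_of_covariance_eq_zero
    (X := fun (p : ι × Set.Iic u) ω ↦ Z p.1 p.2 ω)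
    (Y := fun (k : ι) ω ↦ Z k t ω - expCorr φ (t - u) * Z k u ω) ?_
    (fun p ↦ ((hZ _).measurable _).aemeasurable)
    (fun k ↦ (((hZ _).measurable _).sub (((hZ _).measurable _).const_mul _)).aemeasurable)
    fun p k ↦ ?_
  · refine hG.of_isGaussianProcess ?_
    rintro (⟨k, x⟩ | k)
    · refine ⟨{(k, x.1)}, ContinuousLinearMap.proj ⟨(k, x.1), by simp⟩, fun ω ↦ by simp⟩
    · refine ⟨{(k, t), (k, u)}, ContinuousLinearMap.proj ⟨(k, t), by simp⟩
        - expCorr φ (t - u) • ContinuousLinearMap.proj ⟨(k, u), by simp⟩, fun ω ↦ by simp⟩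
  -- Within one process the covariance vanishes by the Markov property, across processes by their
  -- independence.
  · obtain ⟨l, x, hx⟩ := p
    rw [covariance_comm]
    rcases eq_or_ne l k with rfl | hlk
    · exact (hZ l).covariance_innovation hx hut
    · have h : IndepFun (fun ω ↦ Z k t ω - expCorr φ (t - u) * Z k u ω) (Z l x) P :=
        (hindep.indepFun hlk.symm).comp
        (φ := fun z : S → ℝ ↦ z t - expCorr φ (t - u) * z u) (ψ := fun z : S → ℝ ↦ z x)
        (by fun_prop) (measurable_pi_apply x)
      exact h.covariance_eq_zero (((hZ k).memLp t).sub (((hZ k).memLp u).const_mul _))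
        ((hZ l).memLp x)

/-- The joint law of the innovations of two independent processes. -/
theorem map_pair_sub_const_mul {Z : Fin 2 → S → Ω → ℝ} (hZ : ∀ k, IsExpGaussianProcess φ (Z k) P)
    (hindep : iIndepFun (fun (k : Fin 2) (ω : Ω) (t : S) ↦ Z k t ω) P) (t u : S) (c : ℝ) :
    P.map (fun ω ↦ (Z 0 t ω - c * Z 0 u ω, Z 1 t ω - c * Z 1 u ω))
      = (gaussianReal 0 (1 - 2 * c * expCorr φ (t - u) + c ^ 2).toNNReal).prod
        (gaussianReal 0 (1 - 2 * c * expCorr φ (t - u) + c ^ 2).toNNReal) := by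
  have hP := hindep.isProbabilityMeasure
  have h := (hindep.indepFun (zero_ne_one (α := Fin 2))).comp
    (φ := fun z : S → ℝ ↦ z t - c * z u) (ψ := fun z : S → ℝ ↦ z t - c * z u)
    (by fun_prop) (by fun_prop)
  have hm (k : Fin 2) : Measurable fun ω ↦ Z k t ω - c * Z k u ω :=
    ((hZ k).measurable t).sub (((hZ k).measurable u).const_mul c)
  have := (indepFun_iff_map_prod_eq_prod_map_map (hm 0).aemeasurable (hm 1).aemeasurable).1 h
  rw [this, (hZ 0).map_sub_const_mul, (hZ 1).map_sub_const_mul]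

end IsExpGaussianProcess

/-! ### Conditioning on part of an independent pair -/

section Independence

variable {Ω β γ δ : Type*} {mΩ : MeasurableSpace Ω} [MeasurableSpace β] [MeasurableSpace γ]
  [MeasurableSpace δ] {P : Measure Ω} {V : Ω → β} {ε : Ω → γ} {F : β → δ}

/-- Tonelli for the product law of `(V, ε)`. The sets `F (V ω) ∈ B` are exactly the events of the
coarser σ-algebra generated by `F ∘ V`. -/
theorem ProbabilityTheory.IndepFun.setLIntegral_comp_prodMk [IsFiniteMeasure P]
    (h : IndepFun V ε P) (hV : Measurable V) (hε : Measurable ε) (hF : Measurable F)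
    {f : β × γ → ℝ≥0∞} (hf : Measurable f) {B : Set δ} (hB : MeasurableSet B) :
    ∫⁻ ω in (fun ω ↦ F (V ω)) ⁻¹' B, f (V ω, ε ω) ∂P
      = ∫⁻ ω in (fun ω ↦ F (V ω)) ⁻¹' B, ∫⁻ e, f (V ω, e) ∂(P.map ε) ∂P := by
  have hA : MeasurableSet (F ⁻¹' B) := hF hB
  have hmap := (indepFun_iff_map_prod_eq_prod_map_map hV.aemeasurable hε.aemeasurable).1 h
  have hset : (fun ω ↦ F (V ω)) ⁻¹' B = V ⁻¹' (F ⁻¹' B) := rfl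
  have hset' : V ⁻¹' (F ⁻¹' B) = (fun ω ↦ (V ω, ε ω)) ⁻¹' ((F ⁻¹' B) ×ˢ Set.univ) := by
    ext; simp
  rw [hset, ← setLIntegral_map (f := fun v ↦ ∫⁻ e, f (v, e) ∂(P.map ε)) hA
    hf.lintegral_prod_right' hV, hset',
    ← setLIntegral_map (f := f) (hA.prod .univ) hf (hV.prodMk hε), hmap,
    ← Measure.prod_restrict, Measure.restrict_univ, lintegral_prod _ hf.aemeasurable]

/-- Conditional expectation of a function of an observed and an independent variable. -/
theorem ProbabilityTheory.IndepFun.condExp_comp_prodMk_eq [IsFiniteMeasure P]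
    (h : IndepFun V ε P) (hV : Measurable V) (hε : Measurable ε) (hF : Measurable F)
    {f : β × γ → ℝ} (hf : Measurable f) (hf0 : ∀ p, 0 ≤ f p)
    (hint : Integrable (fun ω ↦ f (V ω, ε ω)) P)
    {M : δ → ℝ} (hM : Measurable M) (hM0 : ∀ v, 0 ≤ M (F v))
    (hfM : ∀ v, ∫⁻ e, ENNReal.ofReal (f (v, e)) ∂(P.map ε) = ENNReal.ofReal (M (F v))) :
    P[fun ω ↦ f (V ω, ε ω) | MeasurableSpace.comap (fun ω ↦ F (V ω)) inferInstance]
      =ᵐ[P] fun ω ↦ M (F (V ω)) := by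
  have hFV : Measurable fun ω ↦ F (V ω) := hF.comp hV
  have hset {B : Set δ} (hB : MeasurableSet B) :
      ∫⁻ ω in (fun ω ↦ F (V ω)) ⁻¹' B, ENNReal.ofReal (f (V ω, ε ω)) ∂P
        = ∫⁻ ω in (fun ω ↦ F (V ω)) ⁻¹' B, ENNReal.ofReal (M (F (V ω))) ∂P := by
    rw [h.setLIntegral_comp_prodMk hV hε hF (f := fun p ↦ ENNReal.ofReal (f p))
      (by fun_prop) hB]
    simp_rw [hfM]
  have hMint : Integrable (fun ω ↦ M (F (V ω))) P := by
    refine (lintegral_ofReal_ne_top_iff_integrable (hM.comp hFV).aestronglyMeasurable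
      (ae_of_all _ fun ω ↦ hM0 _)).1 ?_
    have := hset (B := Set.univ) .univ
    simp only [Set.preimage_univ, Measure.restrict_univ] at this
    refine this ▸ ?_
    exact (lintegral_ofReal_ne_top_iff_integrable hint.1 (ae_of_all _ fun ω ↦ hf0 _)).2 hint
  refine (ae_eq_condExp_of_forall_setIntegral_eq hFV.comap_le hint
    (fun _ _ _ ↦ hMint.integrableOn) ?_ ?_).symm
  · rintro _ ⟨B, hB, rfl⟩ -
    rw [integral_eq_lintegral_of_nonneg_ae (ae_of_all _ fun ω ↦ hM0 _) hMint.1.restrict,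
      integral_eq_lintegral_of_nonneg_ae (ae_of_all _ fun ω ↦ hf0 _) hint.1.restrict, hset hB]
  · exact (hM.comp (comap_measurable _)).stronglyMeasurable.aestronglyMeasurable

end Independence

/-- If `g ∘ O` is a version of the conditional expectation of `U` given `O`, then the regular
conditional distribution of `U` given `O` has mean `g`. -/
theorem ae_map_integral_condDistrib_eq {Ω β : Type*} [MeasurableSpace Ω] [MeasurableSpace β]
    {P : Measure Ω} [IsFiniteMeasure P] {U : Ω → ℝ} {O : Ω → β} (hU : Measurable U)
    (hO : Measurable O) {f : ℝ → ℝ} (hf : Measurable f) (hint : Integrable (fun ω ↦ f (U ω)) P)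
    {g : β → ℝ} (hg : Measurable g)
    (h : P[fun ω ↦ f (U ω) | MeasurableSpace.comap O inferInstance] =ᵐ[P] fun ω ↦ g (O ω)) :
    ∀ᵐ y ∂(P.map O), Integrable f (condDistrib U O P y) ∧ ∫ t, f t ∂(condDistrib U O P y) = g y := by
  have hfi : Integrable (fun p : β × ℝ ↦ f p.2) (P.map fun ω ↦ (O ω, U ω)) :=
    (integrable_map_measure (hf.comp measurable_snd).aestronglyMeasurable
      (hO.prodMk hU).aemeasurable).2 hint
  have h1 : ∀ᵐ y ∂(P.map O), Integrable f (condDistrib U O P y) :=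
    hfi.condDistrib_ae_map hU.aemeasurable
  have h2 : ∀ᵐ y ∂(P.map O), ∫ t, f t ∂(condDistrib U O P y) = g y := by
    have hmeas : MeasurableSet {y | ∫ t, f t ∂(condDistrib U O P y) = g y} :=
      measurableSet_eq_fun
        (hf.stronglyMeasurable.integral_kernel (κ := condDistrib U O P)).measurable hg
    rw [ae_map_iff hO.aemeasurable hmeas]
    filter_upwards [h, condExp_ae_eq_integral_condDistrib hO hU.aemeasurable
      hf.stronglyMeasurable hint] with ω hω hω'
    rw [← hω', hω]
  filter_upwards [h1, h2] with y hy hy' using ⟨hy, hy'⟩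

/-! ### Optimal prediction in mean square -/

section Predictor

variable {Ω β : Type*} [MeasurableSpace Ω] [MeasurableSpace β] {P : Measure Ω}

theorem mspe_lt_top_iff_memLp {U V : Ω → ℝ} (hUV : AEStronglyMeasurable (fun ω ↦ U ω - V ω) P) :
    mspe P U V < ∞ ↔ MemLp (fun ω ↦ U ω - V ω) 2 P := by
  rw [memLp_two_iff_integrable_sq hUV, lt_top_iff_ne_top, mspe]
  exact lintegral_ofReal_ne_top_iff_integrable (hUV.pow 2) (ae_of_all _ fun ω ↦ sq_nonneg _)

/-- The conditional expectation is the optimal predictor. -/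
theorem isOptimalPredictor_of_condExp_ae_eq [IsProbabilityMeasure P] {U : Ω → ℝ} {O : Ω → β}
    (hU : MemLp U 2 P) (hO : Measurable O) {g : β → ℝ} (hg : Measurable g)
    (h : P[U | MeasurableSpace.comap O inferInstance] =ᵐ[P] fun ω ↦ g (O ω)) :
    IsOptimalPredictor P U O g := by
  have hgO : MemLp (fun ω ↦ g (O ω)) 2 P := (memLp_congr_ae h).1 (hU.condExp one_le_two)
  have hUg : MemLp (fun ω ↦ U ω - g (O ω)) 2 P := hU.sub hgO
  have hfin : mspe P U (fun ω ↦ g (O ω)) < ∞ := (mspe_lt_top_iff_memLp hUg.1).2 hUg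
  have hpyth (f : β → ℝ) (hf : Measurable f) (hff : mspe P U (fun ω ↦ f (O ω)) < ∞) :
      Integrable (fun ω ↦ (g (O ω) - f (O ω)) ^ 2) P ∧
      mspe P U (fun ω ↦ f (O ω)) = mspe P U (fun ω ↦ g (O ω))
        + ∫⁻ ω, ENNReal.ofReal ((g (O ω) - f (O ω)) ^ 2) ∂P := by
    have hUf : MemLp (fun ω ↦ U ω - f (O ω)) 2 P :=
      (mspe_lt_top_iff_memLp (hU.1.sub (hf.comp hO).aestronglyMeasurable)).1 hff
    have hgf : MemLp (fun ω ↦ g (O ω) - f (O ω)) 2 P := by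
      convert hUf.sub hUg using 1
      ext ω
      simp
    -- Orthogonality: the residual has zero conditional mean and the other factor is a function of
    -- the observations.
    have hcross : ∫ ω, (U ω - g (O ω)) * (g (O ω) - f (O ω)) ∂P = 0 := by
      have hprod : Integrable (fun ω ↦ (U ω - g (O ω)) * (g (O ω) - f (O ω))) P :=
        hUg.integrable_mul hgf
      have hdm : StronglyMeasurable[MeasurableSpace.comap O inferInstance]
          fun ω ↦ g (O ω) - f (O ω) :=
        ((hg.sub hf).comp (comap_measurable O)).stronglyMeasurable
      have hgm : StronglyMeasurable[MeasurableSpace.comap O inferInstance] fun ω ↦ g (O ω) :=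
        (hg.comp (comap_measurable O)).stronglyMeasurable
      have hz : P[fun ω ↦ U ω - g (O ω) | MeasurableSpace.comap O inferInstance] =ᵐ[P] 0 := by
        filter_upwards [condExp_sub (hU.integrable one_le_two) (hgO.integrable one_le_two)
          (MeasurableSpace.comap O inferInstance), h] with ω h1 h2
        rw [condExp_of_stronglyMeasurable hO.comap_le hgm (hgO.integrable one_le_two)] at h1
        refine Eq.trans h1 ?_
        simp [h2]
      rw [← integral_condExp hO.comap_le]
      refine integral_eq_zero_of_ae ?_
      filter_upwards [condExp_mul_of_stronglyMeasurable_right hdm hprod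
        (hUg.integrable one_le_two), hz] with ω h1 h2
      refine Eq.trans h1 ?_
      simp [h2]
    refine ⟨hgf.integrable_sq, ?_⟩
    rw [mspe, mspe, ← ofReal_integral_eq_lintegral_ofReal hUf.integrable_sq
      (ae_of_all _ fun ω ↦ sq_nonneg _), ← ofReal_integral_eq_lintegral_ofReal hUg.integrable_sq
      (ae_of_all _ fun ω ↦ sq_nonneg _), ← ofReal_integral_eq_lintegral_ofReal hgf.integrable_sq
      (ae_of_all _ fun ω ↦ sq_nonneg _), ← ENNReal.ofReal_add
      (integral_nonneg fun ω ↦ sq_nonneg _) (integral_nonneg fun ω ↦ sq_nonneg _)]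
    congr 1
    have hexp : (fun ω ↦ (U ω - f (O ω)) ^ 2) = fun ω ↦ ((U ω - g (O ω)) ^ 2
        + (g (O ω) - f (O ω)) ^ 2) + 2 * ((U ω - g (O ω)) * (g (O ω) - f (O ω))) := by
      ext ω
      ring
    have hsum : Integrable (fun ω ↦ (U ω - g (O ω)) ^ 2 + (g (O ω) - f (O ω)) ^ 2) P :=
      hUg.integrable_sq.add hgf.integrable_sq
    have hprod : Integrable (fun ω ↦ 2 * ((U ω - g (O ω)) * (g (O ω) - f (O ω)))) P :=
      (hUg.integrable_mul hgf).const_mul 2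
    rw [hexp, integral_add hsum hprod, integral_add hUg.integrable_sq hgf.integrable_sq,
      integral_const_mul, hcross, mul_zero, add_zero]
  refine ⟨hg, hfin, fun f hf ↦ ⟨?_, fun heq ↦ ?_⟩⟩
  · rcases eq_or_ne (mspe P U fun ω ↦ f (O ω)) ∞ with htop | htop
    · rw [htop]
      exact le_top
    · rw [(hpyth f hf htop.lt_top).2]
      exact le_self_add
  · obtain ⟨hi, hp⟩ := hpyth f hf (heq ▸ hfin)
    rw [heq] at hp
    -- Equal errors leave no room for the Pythagorean excess; cancelling in `ℝ≥0∞` needs the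
    -- finiteness `hfin`.
    have h0 : ∫⁻ ω, ENNReal.ofReal ((g (O ω) - f (O ω)) ^ 2) ∂P = 0 :=
      (ENNReal.add_right_inj hfin.ne).1 (by rw [add_zero, ← hp])
    rw [lintegral_eq_zero_iff' hi.1.aemeasurable.ennreal_ofReal] at h0
    filter_upwards [h0] with ω hω
    have : (g (O ω) - f (O ω)) ^ 2 ≤ 0 := by simpa using hω
    have := pow_eq_zero_iff two_ne_zero |>.1 (le_antisymm this (sq_nonneg _))
    linarith

end Predictor

/-! ### The Weibull process and the closed form -/

theorem weibullScale_pos {κ : ℝ} (hκ : 0 < κ) : 0 < weibullScale κ :=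
  inv_pos.2 (Real.Gamma_pos_of_pos (by positivity))

theorem scaledChiSq_two {Ω T : Type*} (Z : Fin 2 → T → Ω → ℝ) (t : T) (ω : Ω) :
    scaledChiSq Z t ω = (Z 0 t ω ^ 2 + Z 1 t ω ^ 2) / 2 := by
  rw [scaledChiSq, Fin.sum_univ_two]
  push_cast
  ring

theorem measurable_regWeibullProcess {Ω T : Type*} [MeasurableSpace Ω] (κ : ℝ) (μ : T → ℝ)
    {Z : Fin 2 → T → Ω → ℝ} {t : T} (hZ : ∀ k, Measurable (Z k t)) :
    Measurable (regWeibullProcess κ μ Z t) := by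
  unfold regWeibullProcess weibullProcess scaledChiSq
  fun_prop

theorem regWeibullProcess_rpow {Ω T : Type*} {κ : ℝ} (hκ : 0 < κ) {μ : T → ℝ} {t : T}
    (hμ : 0 < μ t) (Z : Fin 2 → T → Ω → ℝ) (ω : Ω) (a : ℝ) :
    regWeibullProcess κ μ Z t ω ^ a
      = (weibullScale κ * μ t) ^ a * ((Z 0 t ω ^ 2 + Z 1 t ω ^ 2) / 2) ^ (a / κ) := by
  have hw := weibullScale_pos hκ
  rw [regWeibullProcess, weibullProcess, ← mul_assoc, mul_comm (μ t), scaledChiSq_two,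
    Real.mul_rpow (by positivity) (by positivity), ← Real.rpow_mul (by positivity),
    one_div_mul_eq_div]

/-- The conditional moment in terms of `x = y ^ κ / (ν(κ) μ₀) ^ κ`: the parameter `r` cancels. -/
theorem weibullCondMoment_eq {κ a r q μ₀ μ₁ y x : ℝ} (hκ : 0 < κ) (hμ₀ : 0 < μ₀)
    (hr : r ^ 2 < 1) (hq : q ^ 2 < 1) (hy : y ^ κ = (weibullScale κ * μ₀) ^ κ * x) :
    weibullCondMoment κ a r q μ₀ μ₁ y = (weibullScale κ * μ₁) ^ a
      * (Real.Gamma (a / κ + 1) * (1 - q ^ 2) ^ (a / κ) * Real.exp (-(q ^ 2 * x / (1 - q ^ 2)))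
        * hyp1F1 (a / κ + 1) 1 (q ^ 2 * x / (1 - q ^ 2))) := by
  have hw := weibullScale_pos hκ
  have hc : 0 < (weibullScale κ * μ₀) ^ κ := by positivity
  have hr' : 0 < 1 - r ^ 2 := sub_pos.2 hr
  have hq' : 0 < 1 - q ^ 2 := sub_pos.2 hq
  -- The bracket equals `q ^ 2 * (1 - r ^ 2) / (1 - q ^ 2)`, so its factor `1 - r ^ 2` cancels the
  -- denominator.
  have e1 : y ^ κ / ((1 - r ^ 2) * (weibullScale κ * μ₀) ^ κ)
      * ((1 - r ^ 2 * q ^ 2) / (1 - q ^ 2) - 1) = q ^ 2 * x / (1 - q ^ 2) := by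
    rw [hy]
    field_simp
    ring
  have e2 : q ^ 2 * y ^ κ / ((weibullScale κ * μ₀) ^ κ * (1 - q ^ 2)) = q ^ 2 * x / (1 - q ^ 2) := by
    rw [hy]
    field_simp
  rw [weibullCondMoment, e1, e2]
  ring

theorem measurable_weibullCondMoment {κ a : ℝ} (hκ : 0 < κ) (ha : 0 < a) (r q μ₀ μ₁ : ℝ) :
    Measurable (weibullCondMoment κ a r q μ₀ μ₁) := by
  have hF : Measurable (hyp1F1 (a / κ + 1) 1) := measurable_hyp1F1 (by positivity) one_pos
  unfold weibullCondMoment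
  fun_prop

/-- Translation of the two coordinates of a planar Gaussian vector. -/
theorem ProbabilityTheory.lintegral_gaussianReal_prod_add_const (v : ℝ≥0) (m₁ m₂ : ℝ)
    {f : ℝ × ℝ → ℝ≥0∞} (hf : Measurable f) :
    ∫⁻ p, f (p.1 + m₁, p.2 + m₂) ∂((gaussianReal 0 v).prod (gaussianReal 0 v))
      = ∫⁻ p, f p ∂((gaussianReal m₁ v).prod (gaussianReal m₂ v)) := by
  have h (m : ℝ) : gaussianReal m v = (gaussianReal 0 v).map (· + m) := by
    rw [gaussianReal_map_add_const, zero_add]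
  rw [h m₁, h m₂, Measure.map_prod_map _ _ (by fun_prop) (by fun_prop),
    lintegral_map hf (by fun_prop)]
  rfl

/-! ### Moments and conditional moments of the Weibull process -/

namespace IsExpGaussianProcess

variable {Ω : Type*} [MeasurableSpace Ω] {P : Measure Ω} {S : Set ℝ} {φ κ : ℝ}
  {Z : Fin 2 → S → Ω → ℝ} {μ : S → ℝ}

/-- All positive moments of the regression Weibull process are finite. -/
theorem integrable_regWeibullProcess_rpow (hκ : 0 < κ) (hμ : ∀ t, 0 < μ t)
    (hZ : ∀ k, IsExpGaussianProcess φ (Z k) P)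
    (hindep : iIndepFun (fun (k : Fin 2) (ω : Ω) (t : S) ↦ Z k t ω) P) (t : S) {a : ℝ}
    (ha : 0 ≤ a) : Integrable (fun ω ↦ regWeibullProcess κ μ Z t ω ^ a) P := by
  have hm (k : Fin 2) : Measurable (Z k t) := (hZ k).measurable t
  simp_rw [regWeibullProcess_rpow hκ (hμ t)]
  refine Integrable.const_mul ?_ _
  refine (lintegral_ofReal_ne_top_iff_integrable
    (Measurable.aestronglyMeasurable (by fun_prop)) (ae_of_all _ fun ω ↦ by positivity)).1 ?_
  -- With coefficient `0` the innovations are the values themselves, a standard planar Gaussian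
  -- pair.
  have hlaw := map_pair_sub_const_mul hZ hindep t t 0
  simp only [zero_mul, sub_zero, mul_zero, ne_eq, OfNat.ofNat_ne_zero, not_false_eq_true, zero_pow,
    add_zero, Real.toNNReal_one] at hlaw
  rw [← lintegral_map (f := fun p : ℝ × ℝ ↦ ENNReal.ofReal (((p.1 ^ 2 + p.2 ^ 2) / 2) ^ (a / κ)))
    (g := fun ω ↦ (Z 0 t ω, Z 1 t ω)) (by fun_prop) (by fun_prop), hlaw,
    lintegral_half_sq_norm_rpow_gaussianReal_prod _ _ one_ne_zero (by positivity)]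
  exact ENNReal.ofReal_ne_top

/-- Conditional moments of the regression Weibull process given observations at times up to `u`,
the time `u` being among them. -/
theorem condExp_regWeibullProcess_rpow {ι : Type*} (hφ : 0 < φ) (hκ : 0 < κ) (hμ : ∀ t, 0 < μ t)
    (hZ : ∀ k, IsExpGaussianProcess φ (Z k) P)
    (hindep : iIndepFun (fun (k : Fin 2) (ω : Ω) (t : S) ↦ Z k t ω) P) {t : S} {τ : ι → S} {i₀ : ι}
    (hτ : ∀ i, τ i ≤ τ i₀) (ht : τ i₀ < t) {a r : ℝ} (ha : 0 < a) (hr : r ^ 2 < 1) :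
    P[fun ω ↦ regWeibullProcess κ μ Z t ω ^ a | MeasurableSpace.comap
        (fun ω i ↦ regWeibullProcess κ μ Z (τ i) ω) inferInstance]
      =ᵐ[P] fun ω ↦ weibullCondMoment κ a r (expCorr φ (τ i₀ - t)) (μ (τ i₀)) (μ t)
        (regWeibullProcess κ μ Z (τ i₀) ω) := by
  have hP := hindep.isProbabilityMeasure
  set u : S := τ i₀ with hu
  have hutR : (u : ℝ) - t ≠ 0 := sub_ne_zero.2 fun h ↦ ht.ne (Subtype.ext h)
  set q : ℝ := expCorr φ (u - t) with hq
  have hq' : expCorr φ (t - u) = q := by rw [hq, ← neg_sub (t : ℝ), expCorr_neg]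
  have hq1 : q ^ 2 < 1 := expCorr_sq_lt_one hφ hutR
  have hv1 : (0 : ℝ) < 1 - q ^ 2 := sub_pos.2 hq1
  set v : ℝ≥0 := (1 - q ^ 2).toNNReal with hv
  have hvc : (v : ℝ) = 1 - q ^ 2 := Real.coe_toNNReal _ hv1.le
  have hv0 : v ≠ 0 := (Real.toNNReal_pos.2 hv1).ne'
  let past : Ω → Fin 2 × Set.Iic u → ℝ := fun ω p ↦ Z p.1 p.2 ω
  let ε : Ω → Fin 2 → ℝ := fun ω k ↦ Z k t ω - q * Z k u ω
  -- On path space the coordinates `C` play the role of `Z`, so `F` exhibits the observations as a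
  -- function of the past.
  let C : Fin 2 → Set.Iic u → (Fin 2 × Set.Iic u → ℝ) → ℝ := fun k x z ↦ z (k, x)
  let F : (Fin 2 × Set.Iic u → ℝ) → ι → ℝ := fun z i ↦
    regWeibullProcess κ (fun x : Set.Iic u ↦ μ x) C ⟨τ i, hτ i⟩ z
  let u' : Set.Iic u := ⟨u, Set.mem_Iic.2 le_rfl⟩
  let f : (Fin 2 × Set.Iic u → ℝ) × (Fin 2 → ℝ) → ℝ := fun p ↦ (weibullScale κ * μ t) ^ a
    * (((p.2 0 + q * p.1 (0, u')) ^ 2 + (p.2 1 + q * p.1 (1, u')) ^ 2) / 2) ^ (a / κ)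
  let M : (ι → ℝ) → ℝ := fun y ↦ weibullCondMoment κ a r q (μ u) (μ t) (y i₀)
  have hw := weibullScale_pos hκ
  have hc : 0 < weibullScale κ * μ t := mul_pos hw (hμ t)
  have hpast : Measurable past := measurable_pi_lambda _ fun p ↦ (hZ _).measurable _
  have hε : Measurable ε := measurable_pi_lambda _ fun k ↦
    ((hZ k).measurable t).sub (((hZ k).measurable u).const_mul q)
  have hF : Measurable F := measurable_pi_lambda _ fun i ↦
    measurable_regWeibullProcess _ _ fun k ↦ measurable_pi_apply _
  have hMm : Measurable M := (measurable_weibullCondMoment hκ ha _ _ _ _).comp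
    (measurable_pi_apply i₀)
  have hf : Measurable f := by fun_prop
  have hf_eq (ω : Ω) : regWeibullProcess κ μ Z t ω ^ a = f (past ω, ε ω) := by
    simp only [f, past, ε, u', sub_add_cancel]
    exact regWeibullProcess_rpow hκ (hμ t) Z ω a
  have hMF (z : Fin 2 × Set.Iic u → ℝ) : M (F z) = (weibullScale κ * μ t) ^ a
      * (Real.Gamma (a / κ + 1) * (v : ℝ) ^ (a / κ)
        * Real.exp (-(((q * z (0, u')) ^ 2 + (q * z (1, u')) ^ 2) / (2 * v)))
        * hyp1F1 (a / κ + 1) 1 (((q * z (0, u')) ^ 2 + (q * z (1, u')) ^ 2) / (2 * v))) := by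
    have hx : ((q * z (0, u')) ^ 2 + (q * z (1, u')) ^ 2) / (2 * (v : ℝ))
        = q ^ 2 * ((z (0, u') ^ 2 + z (1, u') ^ 2) / 2) / (1 - q ^ 2) := by
      rw [hvc]
      field_simp
    rw [hx, hvc]
    -- The power `κ` of the observation at `u` recovers half the squared norm there, up to scale.
    refine weibullCondMoment_eq hκ (hμ u) hr hq1 ?_
    have h := regWeibullProcess_rpow hκ (μ := fun x : Set.Iic u ↦ μ x) (t := u') (hμ u) C z κ
    rw [div_self hκ.ne', Real.rpow_one] at h
    exact h
  have hM0 (z : Fin 2 × Set.Iic u → ℝ) : 0 ≤ M (F z) := by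
    have hΓ : 0 < Real.Gamma (a / κ + 1) := Real.Gamma_pos_of_pos (by positivity)
    have hh := hyp1F1_nonneg (a := a / κ + 1) (b := 1)
      (x := ((q * z (0, u')) ^ 2 + (q * z (1, u')) ^ 2) / (2 * (v : ℝ))) (by positivity) one_pos
      (by positivity)
    rw [hMF]
    positivity
  have hlaw := map_pair_sub_const_mul hZ hindep t u q
  rw [hq', show 1 - 2 * q * q + q ^ 2 = 1 - q ^ 2 by ring, ← hv] at hlaw
  have hfM (z : Fin 2 × Set.Iic u → ℝ) :
      ∫⁻ e, ENNReal.ofReal (f (z, e)) ∂(P.map ε) = ENNReal.ofReal (M (F z)) := by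
    let g : ℝ × ℝ → ℝ≥0∞ := fun p ↦ ENNReal.ofReal (((p.1 ^ 2 + p.2 ^ 2) / 2) ^ (a / κ))
    have hg : Measurable g := by fun_prop
    have hε' : Measurable fun ω ↦ (ε ω 0, ε ω 1) := by fun_prop
    calc ∫⁻ e, ENNReal.ofReal (f (z, e)) ∂(P.map ε)
        = ∫⁻ ω, ENNReal.ofReal (f (z, ε ω)) ∂P := lintegral_map (by fun_prop) hε
      _ = ∫⁻ ω, ENNReal.ofReal ((weibullScale κ * μ t) ^ a)
            * g (ε ω 0 + q * z (0, u'), ε ω 1 + q * z (1, u')) ∂P :=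
          lintegral_congr fun ω ↦ ENNReal.ofReal_mul (by positivity)
      _ = ENNReal.ofReal ((weibullScale κ * μ t) ^ a)
            * ∫⁻ ω, g (ε ω 0 + q * z (0, u'), ε ω 1 + q * z (1, u')) ∂P :=
          lintegral_const_mul' _ _ ENNReal.ofReal_ne_top
      _ = ENNReal.ofReal ((weibullScale κ * μ t) ^ a)
            * ∫⁻ p, g (p.1 + q * z (0, u'), p.2 + q * z (1, u'))
              ∂((gaussianReal 0 v).prod (gaussianReal 0 v)) := by
          rw [← hlaw]
          congr 1
          exact (lintegral_map (f := fun p : ℝ × ℝ ↦ g (p.1 + q * z (0, u'), p.2 + q * z (1, u')))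
            (by fun_prop) hε').symm
      _ = ENNReal.ofReal (M (F z)) := by
          -- With the past frozen at `z`, the shift by `q * z` becomes the Gaussian mean.
          rw [lintegral_gaussianReal_prod_add_const _ _ _ hg,
            lintegral_half_sq_norm_rpow_gaussianReal_prod _ _ hv0 (by positivity),
            ← ENNReal.ofReal_mul (by positivity), hMF]
  have hind : IndepFun past ε P := by
    have := indepFun_past_innovation hZ hindep ht.le
    rwa [hq'] at this
  have hint := integrable_regWeibullProcess_rpow hκ hμ hZ hindep t ha.le
  simp_rw [hf_eq] at hint ⊢
  exact hind.condExp_comp_prodMk_eq hpast hε hF hf (fun p ↦ by positivity) hint hMm hM0 hfM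

end IsExpGaussianProcess

/-! ### The main theorem -/

theorem proposition2 {Ω : Type*} [MeasurableSpace Ω] (P : Measure Ω) [IsProbabilityMeasure P]
    {S : Set ℝ} (φ κ : ℝ) (hφ : 0 < φ) (hκ : 0 < κ)
    (μ : S → ℝ) (hμ : ∀ t, 0 < μ t)
    (Z : Fin 2 → S → Ω → ℝ) (hZ : ∀ k, IsExpGaussianProcess φ (Z k) P)
    (hindep : iIndepFun (fun (k : Fin 2) (ω : Ω) (t : S) ↦ Z k t ω) P)
    (n : ℕ) (hn : 1 ≤ n)
    (s : ℕ → S) (hs : StrictMonoOn s (Set.Icc 1 (n + 1))) :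
    -- `ρ i j = ρ_{i,j}`; `r = ρ_{n-1,n}`, read as `0` when there is no location before `s_n`
    let ρ : ℕ → ℕ → ℝ := fun i j ↦ expCorr φ ((s i : ℝ) - (s j : ℝ))
    let r : ℝ := if 2 ≤ n then ρ (n - 1) n else 0
    let Y : S → Ω → ℝ := regWeibullProcess κ μ Z
    -- the observed vector `(Y(s_1), …, Y(s_n))`
    let obs : Ω → Set.Icc 1 n → ℝ := fun ω i ↦ Y (s i) ω
    -- the closed form as a function of `a` and of `y = (y_1, …, y_n)`
    let M : ℝ → (Set.Icc 1 n → ℝ) → ℝ := fun a y ↦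
      weibullCondMoment κ a r (ρ n (n + 1)) (μ (s n)) (μ (s (n + 1))) (y ⟨n, hn, le_rfl⟩)
    (∀ a : ℝ, 0 < a →
      Integrable (fun ω ↦ Y (s (n + 1)) ω ^ a) P ∧
      (∀ᵐ y ∂(P.map obs),
        Integrable (fun t : ℝ ↦ t ^ a) (condDistrib (Y (s (n + 1))) obs P y) ∧
        ∫ t, t ^ a ∂(condDistrib (Y (s (n + 1))) obs P y) = M a y) ∧
      P[fun ω ↦ Y (s (n + 1)) ω ^ a | MeasurableSpace.comap obs inferInstance]
        =ᵐ[P] fun ω ↦ M a (obs ω)) ∧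
    IsOptimalPredictor P (Y (s (n + 1))) obs (M 1) := by
  intro ρ r Y obs M
  have hn' : n ∈ Set.Icc 1 (n + 1) := ⟨hn, n.le_succ⟩
  have hlt : s n < s (n + 1) := hs hn' ⟨by lia, le_rfl⟩ n.lt_succ_self
  -- This bound is all that is needed of `r`, so the convention `r = 0` for `n = 1` is harmless.
  have hr : r ^ 2 < 1 := by
    simp only [r, ρ]
    split_ifs with h
    · refine expCorr_sq_lt_one hφ (sub_ne_zero.2 fun he ↦ ?_)
      exact (hs (a := n - 1) (b := n) ⟨by lia, by lia⟩ hn' (by lia)).ne (Subtype.ext he)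
    · norm_num
  have hle (i : Set.Icc 1 n) : s i ≤ s n :=
    hs.monotoneOn ⟨i.2.1, i.2.2.trans n.le_succ⟩ hn' i.2.2
  have hYm (t : S) : Measurable (Y t) :=
    measurable_regWeibullProcess κ μ fun k ↦ (hZ k).measurable t
  have hobs : Measurable obs := measurable_pi_lambda _ fun i ↦ hYm _
  have hM {a : ℝ} (ha : 0 < a) : Measurable (M a) :=
    (measurable_weibullCondMoment hκ ha _ _ _ _).comp (measurable_pi_apply _)
  have hint (t : S) {a : ℝ} (ha : 0 ≤ a) : Integrable (fun ω ↦ Y t ω ^ a) P :=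
    IsExpGaussianProcess.integrable_regWeibullProcess_rpow hκ hμ hZ hindep t ha
  have hcond {a : ℝ} (ha : 0 < a) :
      P[fun ω ↦ Y (s (n + 1)) ω ^ a | MeasurableSpace.comap obs inferInstance]
        =ᵐ[P] fun ω ↦ M a (obs ω) :=
    IsExpGaussianProcess.condExp_regWeibullProcess_rpow hφ hκ hμ hZ hindep
      (τ := fun i : Set.Icc 1 n ↦ s i) (i₀ := ⟨n, hn, le_rfl⟩) hle hlt ha hr
  refine ⟨fun a ha ↦ ⟨hint _ ha.le, ae_map_integral_condDistrib_eq (hYm _) hobs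
    (by fun_prop) (hint _ ha.le) (hM ha) (hcond ha), hcond ha⟩, ?_⟩
  refine isOptimalPredictor_of_condExp_ae_eq ?_ hobs (hM one_pos) (by simpa using hcond one_pos)
  -- Square integrability is the moment of order `2`.
  refine (memLp_two_iff_integrable_sq (hYm _).aestronglyMeasurable).2 ?_
  simpa using hint (s (n + 1)) (a := 2) zero_le_two
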